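/- Let $m$ parties $A_1,\dots,A_m$ be given. For $l=1,\dots,L$ let $\mathcal E^l=\{\eta^l_i,\rho^l_i\}_{i=1}^{n_l}$ be an ensemble of $m$-party states: $\rho^l_1,\dots,\rho^l_{n_l}$ are density operators on $\mathcal H^l=\bigotimes_{k=1}^m\mathbb C^{d_{l,k}}$, where $A_k$ holds the factor $\mathbb C^{d_{l,k}}$, and $\eta^l_i>0$, $\sum_i\eta^l_i=1$. The sequence ensemble is $$\bigotimes_{l=1}^L\mathcal E^l=\{\eta_{\vec c},\rho_{\vec c}\}_{\vec c},\qquad \eta_{\vec c}=\prod_{l=1}^L\eta^l_{c_l},\quad \rho_{\vec c}=\bigotimes_{l=1}^L\rho^l_{c_l},\quad \vec c\in\prod_{l=1}^L\{1,\dots,n_l\},$$ regarded as an ensemble of $m$-party states in which $A_k$ holds $\bigotimes_{l=1}^L\mathbb C^{d_{l,k}}$. For an ensemble $\mathcal E=\{\eta_i,\rho_i\}_i$ of $m$-party states, let $$p_{\mathsf G}(\mathcal E)=\sup_{M}\sum_i\eta_i\operatorname{Tr}(\rho_iM_i),\qquad p_{\mathsf L}(\mathcal E)=\sup_{M\ \mathrm{LOCC}}\sum_i\eta_i\operatorname{Tr}(\rho_iM_i),$$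 where the first supremum is over all measurements $M=\{M_i\}_i$ ($M_i\ge 0$, $\sum_iM_i=\mathbb 1$), and the second over those that the $m$ parties can realize by local operations and classical communication (LOCC), that is, by a protocol of finitely many rounds in each of which one party performs a local quantum measurement with finitely many outcomes and broadcasts its outcome, the operations of all parties may depend on the outcomes broadcast so far, and the final guess is a function of these outcomes. Then $$\prod_{l=1}^{L}p_{\mathsf L}(\mathcal E^l)=p_{\mathsf L}\Big(\bigotimes_{l=1}^L\mathcal E^l\Big)=p_{\mathsf G}\Big(\bigotimes_{l=1}^L\mathcal E^l\Big)$$ if and only if $p_{\mathsf L}(\mathcal E^l)=p_{\mathsf G}(\mathcal E^l)$ for every $l=1,\dots,L$. -/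

import Mathlib

noncomputable section

namespace LOCCSeq

open Matrix
open scoped ComplexOrder

/-- The tensor product `⨂ₗ A l` of a finite family of (possibly rectangular) matrices, in the product
bases. -/
def piTensor {I : Type} [Fintype I] {a b : I → Type} (A : ∀ i, Matrix (a i) (b i) ℂ) :
    Matrix (∀ i, a i) (∀ i, b i) ℂ :=
  Matrix.of fun x y => ∏ i, A i (x i) (y i)

theorem piTensor_conjTranspose {I : Type} [Fintype I] {a b : I → Type}
    (A : ∀ i, Matrix (a i) (b i) ℂ) : (piTensor A)ᴴ = piTensor fun i => (A i)ᴴ := by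
  ext x y
  simp [piTensor, Matrix.conjTranspose_apply]

theorem piTensor_mul {I : Type} [Fintype I] [DecidableEq I] {a b c : I → Type}
    [∀ i, Fintype (b i)] (A : ∀ i, Matrix (a i) (b i) ℂ) (B : ∀ i, Matrix (b i) (c i) ℂ) :
    piTensor A * piTensor B = piTensor fun i => A i * B i := by
  ext x y
  simp [piTensor, Matrix.mul_apply, Finset.prod_univ_sum, Finset.prod_mul_distrib]

theorem piTensor_trace {I : Type} [Fintype I] [DecidableEq I] {a : I → Type}
    [∀ i, Fintype (a i)] (A : ∀ i, Matrix (a i) (a i) ℂ) :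
    (piTensor A).trace = ∏ i, (A i).trace := by
  simp [piTensor, Matrix.trace, Finset.prod_univ_sum]

theorem piTensor_posSemidef {I : Type} [Fintype I] [DecidableEq I] {a : I → Type}
    [∀ i, Fintype (a i)] (A : ∀ i, Matrix (a i) (a i) ℂ) (hA : ∀ i, (A i).PosSemidef) :
    (piTensor A).PosSemidef := by
  classical
  have h : ∀ i, ∃ B : Matrix (a i) (a i) ℂ, A i = Bᴴ * B := fun i => by
    open scoped MatrixOrder in
    exact CStarAlgebra.nonneg_iff_eq_star_mul_self.mp (hA i).nonneg
  choose B hB using h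
  have : piTensor A = (piTensor B)ᴴ * piTensor B := by
    rw [piTensor_conjTranspose, piTensor_mul]
    congr 1
    funext i
    exact hB i
  rw [this]
  exact Matrix.posSemidef_conjTranspose_mul_self _

/-- A quantum state ensemble `{η_i, ρ_i}` on the Hilbert space with orthonormal basis `H`: density
operators `ρ_i` prepared with nonzero probabilities `η_i`. -/
structure Ensemble (Ω H : Type) [Fintype Ω] [Fintype H] where
  prob : Ω → ℝ
  state : Ω → Matrix H H ℂ
  prob_pos : ∀ i, 0 < prob i
  prob_sum : ∑ i, prob i = 1
  state_posSemidef : ∀ i, (state i).PosSemidef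
  state_trace : ∀ i, (state i).trace = 1

/-- The average probability `∑ i, η_i Tr(ρ_i M_i)` of guessing correctly with the measurement `M`. -/
def Ensemble.success {Ω H : Type} [Fintype Ω] [Fintype H] (E : Ensemble Ω H)
    (M : Ω → Matrix H H ℂ) : ℝ :=
  ∑ i, E.prob i * ((E.state i * M i).trace).re

/-- A measurement: positive semidefinite operators that sum to the identity. -/
def IsMeasurement {Ω H : Type} [Fintype Ω] [Fintype H] [DecidableEq H]
    (M : Ω → Matrix H H ℂ) : Prop :=
  (∀ i, (M i).PosSemidef) ∧ ∑ i, M i = 1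

/-- `IsLOCC ι M`: the parties `k : P`, where party `k` holds a system with orthonormal basis `ι k`,
can realize the measurement `M` by local operations and classical communication.

* `guess c`: the parties stop and announce the outcome `c`.
* `round`: party `k` performs a local measurement with Kraus operators `B j k` (`j : Fin r`) and
  broadcasts the outcome `j`; given `j`, every other party `l` applies a local isometry `B j l`, for
  instance the identity or the adjunction of an ancilla.  Then the parties go on with an LOCC
  measurement `N j`, chosen according to `j`, of the resulting systems `ι' j`, whose dimensions may
  have changed.  The operators of the whole measurement are
  `∑ j, (⨂ₗ B j l)ᴴ * N j c * (⨂ₗ B j l)`.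

General local instruments and channels, local and shared randomness, and final classical processing
of the record are all covered: an outcome that is not revealed is one on which what follows does not
depend. -/
inductive IsLOCC {P : Type} [Fintype P] [DecidableEq P] {Ω : Type} [DecidableEq Ω] :
    (ι : P → Type) → [∀ k, Fintype (ι k)] → [∀ k, DecidableEq (ι k)] →
      (Ω → Matrix (∀ k, ι k) (∀ k, ι k) ℂ) → Prop
  | guess (ι : P → Type) [∀ k, Fintype (ι k)] [∀ k, DecidableEq (ι k)] (c : Ω) :
      IsLOCC ι fun c' => if c' = c then 1 else 0
  | round (ι : P → Type) [∀ k, Fintype (ι k)] [∀ k, DecidableEq (ι k)]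
      (k : P) (r : ℕ) (ι' : Fin r → P → Type)
      [∀ j l, Fintype (ι' j l)] [∀ j l, DecidableEq (ι' j l)]
      (B : ∀ (j : Fin r) (l : P), Matrix (ι' j l) (ι l) ℂ)
      (hk : ∑ j, (B j k)ᴴ * B j k = 1)
      (hl : ∀ j l, l ≠ k → (B j l)ᴴ * B j l = 1)
      (N : ∀ j : Fin r, Ω → Matrix (∀ l, ι' j l) (∀ l, ι' j l) ℂ)
      (hN : ∀ j, IsLOCC (ι' j) (N j)) :
      IsLOCC ι fun c => ∑ j, (piTensor (B j))ᴴ * N j c * piTensor (B j)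

/-- `p_G`: the optimal success probability over all measurements. -/
def pG {Ω H : Type} [Fintype Ω] [Fintype H] [DecidableEq H] (E : Ensemble Ω H) : ℝ :=
  sSup {p | ∃ M : Ω → Matrix H H ℂ, IsMeasurement M ∧ p = E.success M}

/-- `p_L`: the optimal success probability over all LOCC measurements among the parties `P`, where
party `k` holds the system with basis `ι k`. -/
def pL {P : Type} [Fintype P] [DecidableEq P] {ι : P → Type} [∀ k, Fintype (ι k)]
    [∀ k, DecidableEq (ι k)] {Ω : Type} [Fintype Ω] [DecidableEq Ω]
    (E : Ensemble Ω (∀ k, ι k)) : ℝ :=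
  sSup {p | ∃ M : Ω → Matrix (∀ k, ι k) (∀ k, ι k) ℂ, IsLOCC ι M ∧ p = E.success M}

/-- The sequence ensemble `⨂ₗ E l`, with probabilities `∏ₗ η^l_{c l}` and states `⨂ₗ ρ^l_{c l}`.
The `l`-th factor is shared among the parties `k : P`, and party `k` holds its part `ι l k` of every
factor: the local system of party `k` has the basis `∀ l, ι l k`. -/
def Ensemble.tensor {I P : Type} [Fintype I] [DecidableEq I] [Fintype P] [DecidableEq P]
    {ι : I → P → Type} [∀ l k, Fintype (ι l k)] {Ω : I → Type} [∀ l, Fintype (Ω l)]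
    (E : ∀ l, Ensemble (Ω l) (∀ k, ι l k)) :
    Ensemble (∀ l, Ω l) (∀ k, ∀ l, ι l k) where
  prob c := ∏ l, (E l).prob (c l)
  state c := (piTensor fun l => (E l).state (c l)).submatrix
    (fun x l k => x k l) (fun x l k => x k l)
  prob_pos c := Finset.prod_pos fun l _ => (E l).prob_pos (c l)
  prob_sum := by
    have h := Finset.prod_univ_sum (fun l => (Finset.univ : Finset (Ω l)))
      (fun l i => (E l).prob i)
    simp only [(E _).prob_sum, Finset.prod_const_one, Fintype.piFinset_univ] at h
    exact h.symm
  state_posSemidef c :=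
    (piTensor_posSemidef _ fun l => (E l).state_posSemidef (c l)).submatrix _
  state_trace c := by
    have h : (piTensor fun l => (E l).state (c l)).trace = 1 := by
      rw [piTensor_trace]
      exact Finset.prod_eq_one fun l _ => (E l).state_trace (c l)
    rw [← h]
    exact Equiv.sum_comp (Equiv.piComm fun k l => ι l k)
      (fun z => piTensor (fun l => (E l).state (c l)) z z)

end LOCCSeq

end

/-! The global optimum is multiplicative, `pG (⨂ E l) = ∏ pG (E l)`, and the LOCC optimum is
supermultiplicative, `∏ pL (E l) ≤ pL (⨂ E l)`. With `0 < pL ≤ pG` the equivalence follows. If `pL =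
pG` on every factor, the chain `∏ pL ≤ pL (⨂) ≤ pG (⨂) = ∏ pG` collapses. Conversely, the two
equalities give `∏ pL = ∏ pG`, and positive factors with `pL ≤ pG` must then agree one by one.

For `pG`, product measurements give one inequality. The other is semidefinite duality
(`Ensemble.exists_dual`): `pG` is the trace of some `K` above every `η_i ρ_i`, and the tensor
product of such operators is again above all the weighted product states. For `pL`, LOCC protocols
on separate systems can be run one after another (`IsLOCC.tensorMeasurement`). -/

noncomputable section

namespace LOCCSeq

open Matrix
open scoped ComplexOrder Kronecker

/-! ### Semidefinite duality for global measurements. -/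

section Duality

variable {Ω H : Type} [Fintype Ω] [Fintype H] [DecidableEq H]

omit [DecidableEq H] in
theorem exists_eq_conjTranspose_mul_self {A : Matrix H H ℂ} (hA : A.PosSemidef) :
    ∃ B : Matrix H H ℂ, A = Bᴴ * B := by
  classical
  open scoped MatrixOrder in
  exact CStarAlgebra.nonneg_iff_eq_star_mul_self.mp hA.nonneg

omit [DecidableEq H] in
theorem trace_mul_nonneg {A B : Matrix H H ℂ} (hA : A.PosSemidef) (hB : B.PosSemidef) :
    0 ≤ (A * B).trace := by
  obtain ⟨C, rfl⟩ := exists_eq_conjTranspose_mul_self hB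
  rw [← Matrix.mul_assoc, Matrix.trace_mul_comm, ← Matrix.mul_assoc]
  exact (hA.mul_mul_conjTranspose_same C).trace_nonneg

omit [DecidableEq H] in
theorem trace_mul_re_nonneg {A B : Matrix H H ℂ} (hA : A.PosSemidef) (hB : B.PosSemidef) :
    0 ≤ ((A * B).trace).re :=
  (Complex.le_def.mp (trace_mul_nonneg hA hB)).1

omit [DecidableEq H] in
theorem ofReal_trace_mul_re {A B : Matrix H H ℂ} (hA : A.PosSemidef) (hB : B.PosSemidef) :
    (((A * B).trace).re : ℂ) = (A * B).trace :=
  Complex.ext rfl (Complex.le_def.mp (trace_mul_nonneg hA hB)).2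

/-- Weak duality: an operator above all `η_i ρ_i` bounds the success probability. -/
theorem Ensemble.success_le_trace (E : Ensemble Ω H) {K : Matrix H H ℂ}
    (hK : ∀ i, (K - (E.prob i : ℂ) • E.state i).PosSemidef) {M : Ω → Matrix H H ℂ}
    (hM : IsMeasurement M) : E.success M ≤ K.trace.re := by
  have h : K.trace.re = ∑ i, ((K * M i).trace).re := by
    rw [← Complex.re_sum, ← Matrix.trace_sum, ← Matrix.mul_sum, hM.2, Matrix.mul_one]
  rw [h]
  refine Finset.sum_le_sum fun i _ => ?_
  have := trace_mul_re_nonneg (hK i) (hM.1 i)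
  simp [Matrix.sub_mul] at this
  exact this

theorem IsMeasurement.one_sub_posSemidef {M : Ω → Matrix H H ℂ} (hM : IsMeasurement M) (i : Ω) :
    (1 - M i).PosSemidef := by
  classical
  rw [← hM.2, ← Finset.add_sum_erase _ _ (Finset.mem_univ i), add_sub_cancel_left]
  exact Matrix.posSemidef_sum _ fun j _ => hM.1 j

theorem Ensemble.success_le_one (E : Ensemble Ω H) {M : Ω → Matrix H H ℂ}
    (hM : IsMeasurement M) : E.success M ≤ 1 := by
  rw [← E.prob_sum]
  refine Finset.sum_le_sum fun i _ => mul_le_of_le_one_right (E.prob_pos i).le ?_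
  have := trace_mul_re_nonneg (E.state_posSemidef i) (hM.one_sub_posSemidef i)
  simpa [Matrix.mul_sub, E.state_trace i] using this

/-- The real `sSup` of an unbounded set is 0 by convention, so this bound is what makes `pG` a
genuine supremum. -/
theorem Ensemble.bddAbove_success (E : Ensemble Ω H) :
    BddAbove {p | ∃ M : Ω → Matrix H H ℂ, IsMeasurement M ∧ p = E.success M} :=
  ⟨1, by rintro _ ⟨M, hM, rfl⟩; exact E.success_le_one hM⟩

theorem Ensemble.success_le_pG (E : Ensemble Ω H) {M : Ω → Matrix H H ℂ}
    (hM : IsMeasurement M) : E.success M ≤ pG E :=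
  le_csSup E.bddAbove_success ⟨M, hM, rfl⟩

omit [DecidableEq H] in
theorem Ensemble.nonempty (E : Ensemble Ω H) : Nonempty Ω := by
  by_contra h
  rw [not_nonempty_iff] at h
  simpa using E.prob_sum

theorem isMeasurement_guess [DecidableEq Ω] (c : Ω) :
    IsMeasurement fun c' => if c' = c then (1 : Matrix H H ℂ) else 0 := by
  refine ⟨fun i => ?_, by simp⟩
  dsimp only
  split_ifs
  exacts [PosSemidef.one, PosSemidef.zero]

-- Writing `A = Bᴴ * B`, this is the arithmetic-geometric mean inequality applied to each term of
-- the entry. It provides the boundedness behind compactness.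
omit [DecidableEq H] in
theorem norm_entry_le_of_posSemidef {A : Matrix H H ℂ} (hA : A.PosSemidef) (x y : H) :
    ‖A x y‖ ≤ ((A x x).re + (A y y).re) / 2 := by
  obtain ⟨B, rfl⟩ := exists_eq_conjTranspose_mul_self hA
  have hd : ∀ x, ((Bᴴ * B) x x).re = ∑ z, ‖B z x‖ ^ 2 := fun x => by
    simp only [Matrix.mul_apply, Matrix.conjTranspose_apply, Complex.re_sum]
    refine Finset.sum_congr rfl fun z _ => ?_
    rw [← Complex.normSq_eq_norm_sq, Complex.normSq_apply]
    simp
  rw [hd, hd, ← Finset.sum_add_distrib, Finset.sum_div, Matrix.mul_apply]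
  refine (norm_sum_le _ _).trans (Finset.sum_le_sum fun z _ => ?_)
  rw [norm_mul, Matrix.conjTranspose_apply, norm_star]
  linarith [two_mul_le_add_sq ‖B z x‖ ‖B z y‖]

theorem IsMeasurement.norm_entry_le_one {M : Ω → Matrix H H ℂ} (hM : IsMeasurement M)
    (i : Ω) (x y : H) : ‖M i x y‖ ≤ 1 := by
  have h : ∀ x, (M i x x).re ≤ 1 := fun x => by
    have := (Complex.le_def.mp ((hM.one_sub_posSemidef i).diag_nonneg (i := x))).1
    simpa using this
  linarith [norm_entry_le_of_posSemidef (hM.1 i) x y, h x, h y]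

omit [DecidableEq H] in
theorem isClosed_posSemidef : IsClosed {A : Matrix H H ℂ | A.PosSemidef} := by
  simp only [Matrix.posSemidef_iff_dotProduct_mulVec, Set.ofPred_and, Set.ofPred_forall]
  refine IsClosed.inter ?_ (isClosed_iInter fun x => ?_)
  · exact isClosed_eq (by fun_prop) continuous_id
  · exact isClosed_le continuous_const (by fun_prop)

theorem isCompact_setOf_isMeasurement :
    IsCompact {M : Ω → Matrix H H ℂ | IsMeasurement M} := by
  have hc : IsCompact {M : Ω → Matrix H H ℂ |
      ∀ i, M i ∈ {A : Matrix H H ℂ | ∀ x, A x ∈ {v : H → ℂ | ∀ y, v y ∈ Metric.closedBall 0 1}}} :=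
    isCompact_pi_infinite fun _ => isCompact_pi_infinite fun _ => isCompact_pi_infinite fun _ =>
      isCompact_closedBall _ _
  refine hc.of_isClosed_subset ?_ fun M hM i x y => by
    simpa using IsMeasurement.norm_entry_le_one hM i x y
  simp only [IsMeasurement, Set.ofPred_and, Set.ofPred_forall]
  refine IsClosed.inter (isClosed_iInter fun i => ?_) ?_
  · exact isClosed_posSemidef.preimage (continuous_apply (A := fun _ : Ω => Matrix H H ℂ) i)
  · exact isClosed_eq (by fun_prop) continuous_const

/-- The supremum defining `pG` is attained. -/
theorem Ensemble.exists_success_eq_pG (E : Ensemble Ω H) :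
    ∃ M : Ω → Matrix H H ℂ, IsMeasurement M ∧ E.success M = pG E := by
  classical
  obtain ⟨c⟩ := E.nonempty
  obtain ⟨M, hM, hmax⟩ := (isCompact_setOf_isMeasurement (Ω := Ω) (H := H)).exists_isMaxOn
    ⟨_, isMeasurement_guess c⟩ (f := E.success)
    (by unfold Ensemble.success; fun_prop)
  refine ⟨M, hM, le_antisymm (E.success_le_pG hM) (csSup_le ⟨_, M, hM, rfl⟩ ?_)⟩
  rintro _ ⟨M', hM', rfl⟩
  exact hmax hM'

/-- The measurement that first tests for the projector `P` with strength `ε (2 - ε)`, announces `j`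
if the test is positive, and otherwise continues with `M`. -/
theorem IsMeasurement.perturb [DecidableEq Ω] {M : Ω → Matrix H H ℂ} (hM : IsMeasurement M)
    {P : Matrix H H ℂ} (hP : Pᴴ = P) (hPP : P * P = P) (j : Ω) {ε : ℝ} (h0 : 0 ≤ ε) (h1 : ε ≤ 1) :
    IsMeasurement fun i => (1 - (ε : ℂ) • P) * M i * (1 - (ε : ℂ) • P) +
      if i = j then ((ε * (2 - ε) : ℝ) : ℂ) • P else 0 := by
  have hPpos : P.PosSemidef := by
    have := Matrix.posSemidef_conjTranspose_mul_self P
    rwa [hP, hPP] at this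
  have hQ : (1 - (ε : ℂ) • P)ᴴ = 1 - (ε : ℂ) • P := by
    simp [Matrix.conjTranspose_sub, Matrix.conjTranspose_smul, hP]
  refine ⟨fun i => PosSemidef.add ?_ ?_, ?_⟩
  · have := (hM.1 i).conjTranspose_mul_mul_same (1 - (ε : ℂ) • P)
    rwa [hQ] at this
  · split_ifs
    · refine hPpos.smul ?_
      exact_mod_cast mul_nonneg h0 (by linarith)
    · exact PosSemidef.zero
  -- The strength is chosen so that `(1 - ε P)² + ε (2 - ε) P = 1`.
  · rw [Finset.sum_add_distrib, ← Finset.sum_mul, ← Finset.mul_sum, hM.2]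
    simp only [Finset.sum_ite_eq', Finset.mem_univ, if_true, Matrix.mul_one, Matrix.sub_mul,
      Matrix.mul_sub, Matrix.one_mul, Matrix.smul_mul, Matrix.mul_smul, hPP]
    push_cast
    module

/-- The Lagrange operator `½ ∑ i, η_i (ρ_i M_i + M_i ρ_i)` of a measurement. -/
def Ensemble.lagrange (E : Ensemble Ω H) (M : Ω → Matrix H H ℂ) : Matrix H H ℂ :=
  ∑ i, ((E.prob i / 2 : ℝ) : ℂ) • (E.state i * M i + M i * E.state i)

theorem Ensemble.lagrange_isHermitian (E : Ensemble Ω H) {M : Ω → Matrix H H ℂ}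
    (hM : IsMeasurement M) : (E.lagrange M).IsHermitian := by
  unfold Matrix.IsHermitian Ensemble.lagrange
  rw [Matrix.conjTranspose_sum]
  refine Finset.sum_congr rfl fun i _ => ?_
  rw [Matrix.conjTranspose_smul, Matrix.conjTranspose_add, Matrix.conjTranspose_mul,
    Matrix.conjTranspose_mul, (hM.1 i).isHermitian.eq, (E.state_posSemidef i).isHermitian.eq,
    add_comm]
  simp

omit [DecidableEq H] in
theorem Ensemble.lagrange_trace_re (E : Ensemble Ω H) (M : Ω → Matrix H H ℂ) :
    (E.lagrange M).trace.re = E.success M := by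
  simp only [Ensemble.lagrange, Ensemble.success, Matrix.trace_sum, Complex.re_sum]
  refine Finset.sum_congr rfl fun i _ => ?_
  rw [Matrix.trace_smul, Matrix.trace_add, Matrix.trace_mul_comm (M i), smul_eq_mul,
    Complex.re_ofReal_mul, Complex.add_re]
  ring

/-- The coefficient of `ε` is `-2 Tr((K - η_j ρ_j) P)`, with `K` the Lagrange operator; this is the
first-order condition at an optimum. -/
theorem Ensemble.success_perturb [DecidableEq Ω] (E : Ensemble Ω H) (M : Ω → Matrix H H ℂ)
    (P : Matrix H H ℂ) (j : Ω) (ε : ℝ) :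
    E.success (fun i => (1 - (ε : ℂ) • P) * M i * (1 - (ε : ℂ) • P) +
      if i = j then ((ε * (2 - ε) : ℝ) : ℂ) • P else 0) =
    E.success M - 2 * ε * ((E.lagrange M * P).trace).re
      + ε ^ 2 * E.success (fun i => P * M i * P)
      + ε * (2 - ε) * (E.prob j * ((E.state j * P).trace).re) := by
  have hlast : ε * (2 - ε) * (E.prob j * ((E.state j * P).trace).re) =
      ∑ i, E.prob i * ((E.state i *
        (if i = j then ((ε * (2 - ε) : ℝ) : ℂ) • P else 0)).trace).re := by
    rw [Finset.sum_eq_single j]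
    · rw [if_pos rfl, Matrix.mul_smul, Matrix.trace_smul, smul_eq_mul, Complex.re_ofReal_mul]
      ring
    · intro i _ hi
      simp [hi]
    · simp
  have hlag : 2 * ε * ((E.lagrange M * P).trace).re =
      ∑ i, E.prob i * (ε * (((E.state i * (P * M i)).trace).re
        + ((E.state i * (M i * P)).trace).re)) := by
    rw [Ensemble.lagrange, Matrix.sum_mul, Matrix.trace_sum, Complex.re_sum, Finset.mul_sum]
    refine Finset.sum_congr rfl fun i _ => ?_
    have h : (E.state i * (P * M i)).trace = (M i * E.state i * P).trace := by
      rw [← Matrix.mul_assoc, Matrix.trace_mul_comm, Matrix.mul_assoc]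
    rw [h, Matrix.smul_mul, Matrix.trace_smul, smul_eq_mul, Complex.re_ofReal_mul, Matrix.add_mul,
      Matrix.trace_add, Complex.add_re, Matrix.mul_assoc (E.state i)]
    ring
  rw [hlast, hlag]
  simp only [Ensemble.success, Finset.mul_sum, ← Finset.sum_add_distrib, ← Finset.sum_sub_distrib]
  refine Finset.sum_congr rfl fun i _ => ?_
  have h : (1 - (ε : ℂ) • P) * M i * (1 - (ε : ℂ) • P) =
      M i - (ε : ℂ) • (P * M i) - (ε : ℂ) • (M i * P) + ((ε ^ 2 : ℝ) : ℂ) • (P * M i * P) := by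
    simp only [Matrix.sub_mul, Matrix.mul_sub, Matrix.one_mul, Matrix.mul_one, Matrix.smul_mul,
      Matrix.mul_smul]
    push_cast
    module
  rw [h]
  simp only [Matrix.mul_add, Matrix.mul_sub, Matrix.mul_smul, Matrix.trace_add, Matrix.trace_sub,
    Matrix.trace_smul, smul_eq_mul, Complex.add_re, Complex.sub_re, Complex.re_ofReal_mul]
  ring

/-- Divide by `2 ε` and let `ε` tend to 0 from above. -/
theorem nonneg_of_forall_mul_le_sq_mul {a C : ℝ}
    (h : ∀ ε : ℝ, 0 ≤ ε → ε ≤ 1 → -(2 * ε * a) + ε ^ 2 * C ≤ 0) : 0 ≤ a := by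
  have hlim : Filter.Tendsto (fun ε : ℝ => ε * C / 2) (nhdsWithin 0 (Set.Ioi 0)) (nhds 0) := by
    have : Continuous fun ε : ℝ => ε * C / 2 := by fun_prop
    simpa using (this.tendsto 0).mono_left nhdsWithin_le_nhds
  refine le_of_tendsto hlim ?_
  filter_upwards [Ioc_mem_nhdsGT (zero_lt_one' ℝ)] with ε hε
  have := h ε hε.1.le hε.2
  have : ε * (ε * C / 2) ≤ ε * a := by linarith
  exact le_of_mul_le_mul_left this hε.1

/-- Optimality of a measurement in terms of its Lagrange operator. -/
theorem Ensemble.lagrange_sub_posSemidef (E : Ensemble Ω H) {M : Ω → Matrix H H ℂ}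
    (hM : IsMeasurement M) (hopt : E.success M = pG E) (j : Ω) :
    (E.lagrange M - (E.prob j : ℂ) • E.state j).PosSemidef := by
  classical
  have hH : (E.lagrange M - (E.prob j : ℂ) • E.state j).IsHermitian := by
    refine (E.lagrange_isHermitian hM).sub ?_
    unfold Matrix.IsHermitian
    rw [Matrix.conjTranspose_smul, (E.state_posSemidef j).isHermitian.eq]
    simp
  have key : ∀ P : Matrix H H ℂ, Pᴴ = P → P * P = P →
      0 ≤ (((E.lagrange M - (E.prob j : ℂ) • E.state j) * P).trace).re := by
    intro P hP hPP
    -- `C` is the coefficient of `ε²` in `success_perturb`.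
    refine nonneg_of_forall_mul_le_sq_mul (C := E.success (fun i => P * M i * P)
      - E.prob j * ((E.state j * P).trace).re) fun ε h0 h1 => ?_
    have h := E.success_le_pG (hM.perturb hP hPP j h0 h1)
    rw [E.success_perturb, ← hopt] at h
    rw [Matrix.sub_mul, Matrix.trace_sub, Complex.sub_re, Matrix.smul_mul, Matrix.trace_smul,
      smul_eq_mul, Complex.re_ofReal_mul]
    linarith
  rw [hH.posSemidef_iff_eigenvalues_nonneg]
  intro i
  set v : H → ℂ := (hH.eigenvectorBasis i).ofLp
  have hvv : star v ⬝ᵥ v = 1 := by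
    have := inner_self_eq_norm_sq_to_K (𝕜 := ℂ) (hH.eigenvectorBasis i)
    rw [(hH.eigenvectorBasis.orthonormal).1 i, EuclideanSpace.inner_eq_star_dotProduct] at this
    rw [dotProduct_comm]
    simpa using this
  -- Testing against the rank-one projector onto an eigenvector turns the trace into the eigenvalue.
  have h := key (vecMulVec v (star v)) (by simp [Matrix.conjTranspose_vecMulVec])
    (by rw [Matrix.vecMulVec_mul_vecMulVec, hvv, one_smul])
  rw [Matrix.mul_vecMulVec, Matrix.trace_vecMulVec, dotProduct_comm] at h
  rw [Pi.zero_apply, hH.eigenvalues_eq]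
  exact h

/-- Strong duality for the discrimination of quantum states. -/
theorem Ensemble.exists_dual (E : Ensemble Ω H) : ∃ K : Matrix H H ℂ,
    (∀ i, (K - (E.prob i : ℂ) • E.state i).PosSemidef) ∧ K.trace = (pG E : ℂ) := by
  obtain ⟨M, hM, hopt⟩ := E.exists_success_eq_pG
  refine ⟨E.lagrange M, E.lagrange_sub_posSemidef hM hopt, ?_⟩
  have h : star (E.lagrange M).trace = (E.lagrange M).trace := by
    rw [← Matrix.trace_conjTranspose, (E.lagrange_isHermitian hM).eq]
  rw [← hopt, ← E.lagrange_trace_re]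
  exact (Complex.conj_eq_iff_re.mp h).symm

end Duality

/-! ### Algebra and order of tensor products. -/

theorem piTensor_one {I : Type} [Fintype I] [DecidableEq I] {a : I → Type}
    [∀ i, DecidableEq (a i)] : piTensor (fun i => (1 : Matrix (a i) (a i) ℂ)) = 1 := by
  ext x y
  by_cases h : x = y
  · subst h
    simp [piTensor]
  · obtain ⟨i, hi⟩ := Function.ne_iff.mp h
    rw [Matrix.one_apply_ne h]
    exact Finset.prod_eq_zero (Finset.mem_univ i) (Matrix.one_apply_ne hi)

theorem piTensor_smul {I : Type} [Fintype I] {a b : I → Type} (s : I → ℂ)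
    (A : ∀ i, Matrix (a i) (b i) ℂ) :
    piTensor (fun i => s i • A i) = (∏ i, s i) • piTensor A := by
  ext x y
  simp [piTensor, Finset.prod_mul_distrib]

theorem piTensor_sum {I : Type} [Fintype I] [DecidableEq I] {a b β : I → Type}
    [∀ i, Fintype (β i)] (A : ∀ i, β i → Matrix (a i) (b i) ℂ) :
    piTensor (fun i => ∑ j, A i j) = ∑ f : ∀ i, β i, piTensor fun i => A i (f i) := by
  ext x y
  simp [piTensor, Matrix.sum_apply, Finset.prod_univ_sum]

/-- The tensor product is monotone on positive semidefinite operators. -/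
theorem piTensor_sub_posSemidef {I : Type} [Fintype I] [DecidableEq I] {a : I → Type}
    [∀ i, Fintype (a i)] {A B : ∀ i, Matrix (a i) (a i) ℂ} (hA : ∀ i, (A i).PosSemidef)
    (hAB : ∀ i, (B i - A i).PosSemidef) : (piTensor B - piTensor A).PosSemidef := by
  -- Expand the tensor product of `A i + (B i - A i)`: the all-`true` term is `piTensor A`, and all
  -- other terms are positive semidefinite.
  have hB : B = fun i => ∑ s : Bool, if s then A i else B i - A i := by
    funext i
    simp
  have h := piTensor_sum (fun i (s : Bool) => if s then A i else B i - A i)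
  rw [← hB, ← Finset.add_sum_erase _ _ (Finset.mem_univ (fun _ => true))] at h
  simp only [if_true] at h
  rw [h, add_sub_cancel_left]
  refine Matrix.posSemidef_sum _ fun f _ => piTensor_posSemidef _ fun i => ?_
  split_ifs
  exacts [hA i, hAB i]

/-- Only factor `k` depends on `j`, so the sum passes into that factor. This is the completeness
relation of one LOCC round. -/
theorem sum_piTensor_eq_one {P : Type} [Fintype P] [DecidableEq P] {ι : P → Type}
    [∀ k, DecidableEq (ι k)] (k : P) {r : ℕ} (A : ∀ (_ : Fin r) (l : P), Matrix (ι l) (ι l) ℂ)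
    (hk : ∑ j, A j k = 1) (hl : ∀ j l, l ≠ k → A j l = 1) : ∑ j, piTensor (A j) = 1 := by
  rw [← piTensor_one]
  ext x y
  simp only [Matrix.sum_apply, piTensor, Matrix.of_apply]
  simp only [← Finset.mul_prod_erase _ _ (Finset.mem_univ k)]
  rw [← hk, Matrix.sum_apply, Finset.sum_mul]
  refine Finset.sum_congr rfl fun j _ => ?_
  congr 1
  exact Finset.prod_congr rfl fun l hl' => by rw [hl j l (Finset.ne_of_mem_erase hl')]

/-! ### LOCC measurements and their closure under tensor products. -/

section LOCC

variable {P : Type} [Fintype P] [DecidableEq P]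

theorem IsLOCC.isMeasurement {Ω : Type} [Fintype Ω] [DecidableEq Ω] {ι : P → Type}
    [∀ k, Fintype (ι k)] [∀ k, DecidableEq (ι k)]
    {M : Ω → Matrix (∀ k, ι k) (∀ k, ι k) ℂ} (h : IsLOCC ι M) : IsMeasurement M := by
  induction h with
  | guess ι c => exact isMeasurement_guess c
  | round ι k r ι' B hk hl N hN ih =>
    refine ⟨fun c => Matrix.posSemidef_sum _ fun j _ =>
      ((ih j).1 c).conjTranspose_mul_mul_same _, ?_⟩
    rw [Finset.sum_comm]
    refine (Finset.sum_congr rfl fun j _ => ?_).trans (sum_piTensor_eq_one k _ hk hl)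
    rw [← Matrix.sum_mul, ← Matrix.mul_sum, (ih j).2, Matrix.mul_one, piTensor_conjTranspose,
      piTensor_mul]

section Ensemble

variable {Ω : Type} [Fintype Ω] [DecidableEq Ω] {ι : P → Type}
  [∀ k, Fintype (ι k)] [∀ k, DecidableEq (ι k)] (E : Ensemble Ω (∀ k, ι k))

theorem Ensemble.success_le_pL {M : Ω → Matrix (∀ k, ι k) (∀ k, ι k) ℂ} (hM : IsLOCC ι M) :
    E.success M ≤ pL E :=
  le_csSup ⟨1, by rintro _ ⟨M, hM, rfl⟩; exact E.success_le_one hM.isMeasurement⟩ ⟨M, hM, rfl⟩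

theorem Ensemble.pL_le_pG : pL E ≤ pG E := by
  obtain ⟨c⟩ := E.nonempty
  refine csSup_le ⟨_, _, IsLOCC.guess ι c, rfl⟩ ?_
  rintro _ ⟨M, hM, rfl⟩
  exact E.success_le_pG hM.isMeasurement

/-- Always guessing `c` already succeeds with probability `E.prob c`. Positivity is needed to
compare products strictly. -/
theorem Ensemble.pL_pos : 0 < pL E := by
  obtain ⟨c⟩ := E.nonempty
  refine lt_of_lt_of_le ?_ (E.success_le_pL (IsLOCC.guess ι c))
  unfold Ensemble.success
  rw [Finset.sum_eq_single c]
  · simpa [E.state_trace] using E.prob_pos c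
  · intro i _ hi
    simp [hi]
  · simp

end Ensemble

/-- Relabelling of outcomes and of the local bases. -/
theorem IsLOCC.relabel {Ω Ω' : Type} [DecidableEq Ω] [DecidableEq Ω'] (f : Ω' ≃ Ω)
    {ι : P → Type} [∀ k, Fintype (ι k)] [∀ k, DecidableEq (ι k)]
    {M : Ω → Matrix (∀ k, ι k) (∀ k, ι k) ℂ} (h : IsLOCC ι M)
    {κ : P → Type} [∀ k, Fintype (κ k)] [∀ k, DecidableEq (κ k)] (e : ∀ k, κ k ≃ ι k) :
    IsLOCC κ fun c => (M (f c)).submatrix (fun x k => e k (x k)) (fun x k => e k (x k)) := by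
  induction h generalizing κ with
  | guess ι c =>
    convert IsLOCC.guess κ (f.symm c) using 2 with c'
    simp only [Equiv.eq_symm_apply]
    split_ifs
    · exact Matrix.submatrix_one_equiv (Equiv.piCongrRight e)
    · rfl
  | round ι k r ι' B hk hl N hN ih =>
    -- The change of input bases is absorbed into the columns of the first-round operators; the
    -- later rounds only have their outcomes relabelled.
    have := IsLOCC.round κ k r ι' (fun j l => (B j l).submatrix id (e l))
      (by
        have h : ∀ j, ((B j k).submatrix id (e k))ᴴ * (B j k).submatrix id (e k) =
            ((B j k)ᴴ * B j k).submatrix (e k) (e k) := fun j => rfl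
        simp only [h]
        rw [← Matrix.submatrix_one_equiv (e k), ← hk]
        ext x y
        simp [Matrix.sum_apply])
      (fun j l hlk => by
        rw [← Matrix.submatrix_one_equiv (e l), ← hl j l hlk]
        rfl)
      (fun j c => N j (f c)) (fun j => ih j fun _ => Equiv.refl _)
    convert this using 2 with c
    ext x y
    simp only [Matrix.submatrix_apply, Matrix.sum_apply]
    rfl

/-- The tensor product of two operators between multipartite systems, party by party. -/
def tensorParties {ι κ ι' κ' : P → Type} (A : Matrix (∀ k, ι k) (∀ k, ι' k) ℂ)
    (B : Matrix (∀ k, κ k) (∀ k, κ' k) ℂ) :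
    Matrix (∀ k, ι k × κ k) (∀ k, ι' k × κ' k) ℂ :=
  Matrix.of fun x y => A (fun k => (x k).1) (fun k => (y k).1) *
    B (fun k => (x k).2) (fun k => (y k).2)

section tensorParties

variable {ι κ ι' κ' ι'' κ'' : P → Type}

omit [Fintype P] [DecidableEq P] in
theorem tensorParties_conjTranspose (A : Matrix (∀ k, ι k) (∀ k, ι' k) ℂ)
    (B : Matrix (∀ k, κ k) (∀ k, κ' k) ℂ) :
    (tensorParties A B)ᴴ = tensorParties Aᴴ Bᴴ := by
  ext x y
  simp [tensorParties]

theorem tensorParties_mul [∀ k, Fintype (ι' k)] [∀ k, Fintype (κ' k)]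
    (A : Matrix (∀ k, ι k) (∀ k, ι' k) ℂ) (B : Matrix (∀ k, κ k) (∀ k, κ' k) ℂ)
    (A' : Matrix (∀ k, ι' k) (∀ k, ι'' k) ℂ) (B' : Matrix (∀ k, κ' k) (∀ k, κ'' k) ℂ) :
    tensorParties A B * tensorParties A' B' = tensorParties (A * A') (B * B') := by
  ext x y
  simp only [tensorParties, Matrix.mul_apply, Matrix.of_apply, Finset.sum_mul_sum,
    ← Fintype.sum_prod_type']
  rw [← Equiv.sum_comp (Equiv.arrowProdEquivProdArrow P ι' κ')]
  refine Finset.sum_congr rfl fun z _ => ?_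
  exact mul_mul_mul_comm _ _ _ _

omit [Fintype P] [DecidableEq P] in
theorem tensorParties_sum_left {J : Type} (s : Finset J)
    (A : J → Matrix (∀ k, ι k) (∀ k, ι' k) ℂ) (B : Matrix (∀ k, κ k) (∀ k, κ' k) ℂ) :
    tensorParties (∑ j ∈ s, A j) B = ∑ j ∈ s, tensorParties (A j) B := by
  ext x y
  simp [tensorParties, Matrix.sum_apply, Finset.sum_mul]

omit [Fintype P] [DecidableEq P] in
theorem tensorParties_sum_right {J : Type} (s : Finset J)
    (A : Matrix (∀ k, ι k) (∀ k, ι' k) ℂ) (B : J → Matrix (∀ k, κ k) (∀ k, κ' k) ℂ) :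
    tensorParties A (∑ j ∈ s, B j) = ∑ j ∈ s, tensorParties A (B j) := by
  ext x y
  simp [tensorParties, Matrix.sum_apply, Finset.mul_sum]

omit [DecidableEq P] in
theorem tensorParties_piTensor (A : ∀ k, Matrix (ι k) (ι' k) ℂ) (B : ∀ k, Matrix (κ k) (κ' k) ℂ) :
    tensorParties (piTensor A) (piTensor B) = piTensor fun k => A k ⊗ₖ B k := by
  ext x y
  simp [tensorParties, piTensor, Finset.prod_mul_distrib, Matrix.kroneckerMap]

theorem tensorParties_one [∀ k, DecidableEq (ι k)] [∀ k, DecidableEq (κ k)] :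
    tensorParties (1 : Matrix (∀ k, ι k) (∀ k, ι k) ℂ) (1 : Matrix (∀ k, κ k) (∀ k, κ k) ℂ) = 1 := by
  rw [← piTensor_one, ← piTensor_one, tensorParties_piTensor, ← piTensor_one]
  congr 1
  funext k
  exact Matrix.one_kronecker_one

theorem tensorParties_conj [∀ k, Fintype (ι k)] [∀ k, Fintype (κ k)]
    (A : Matrix (∀ k, ι k) (∀ k, ι' k) ℂ) (B : Matrix (∀ k, κ k) (∀ k, κ' k) ℂ)
    (M : Matrix (∀ k, ι k) (∀ k, ι k) ℂ) (N : Matrix (∀ k, κ k) (∀ k, κ k) ℂ) :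
    tensorParties (Aᴴ * M * A) (Bᴴ * N * B) =
      (tensorParties A B)ᴴ * tensorParties M N * tensorParties A B := by
  rw [tensorParties_conjTranspose, tensorParties_mul, tensorParties_mul]

end tensorParties

theorem kronecker_conjTranspose_mul_self {a b a' b' : Type} [Fintype a] [Fintype b]
    (A : Matrix a a' ℂ) (B : Matrix b b' ℂ) :
    (A ⊗ₖ B)ᴴ * (A ⊗ₖ B) = (Aᴴ * A) ⊗ₖ (Bᴴ * B) := by
  rw [Matrix.conjTranspose_kronecker, ← Matrix.mul_kronecker_mul]

section Product

variable {Ω₁ Ω₂ : Type} [DecidableEq Ω₁] [DecidableEq Ω₂]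
  {ι κ : P → Type} [∀ k, Fintype (ι k)] [∀ k, DecidableEq (ι k)]
  [∀ k, Fintype (κ k)] [∀ k, DecidableEq (κ k)]

/-- The first protocol has stopped with `c`; its systems are carried along by identity factors while
the second protocol runs. -/
theorem IsLOCC.guess_tensorParties (c : Ω₁) {N : Ω₂ → Matrix (∀ k, κ k) (∀ k, κ k) ℂ}
    (hN : IsLOCC κ N) :
    IsLOCC (fun k => ι k × κ k) fun o : Ω₁ × Ω₂ =>
      tensorParties (if o.1 = c then (1 : Matrix (∀ k, ι k) (∀ k, ι k) ℂ) else 0) (N o.2) := by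
  induction hN with
  | guess κ c' =>
    convert IsLOCC.guess (fun k => ι k × κ k) (c, c') using 2 with o
    obtain ⟨o₁, o₂⟩ := o
    simp only [Prod.mk.injEq]
    by_cases h₁ : o₁ = c <;> by_cases h₂ : o₂ = c' <;>
      simp only [h₁, h₂, if_true, if_false, and_true, and_false]
    · exact tensorParties_one
    all_goals ext x y; simp [tensorParties]
  | round κ k r κ' B hk hl N hN ih =>
    have := IsLOCC.round (fun k => ι k × κ k) k r (fun j l => ι l × κ' j l)
      (fun j l => (1 : Matrix (ι l) (ι l) ℂ) ⊗ₖ B j l)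
      (by
        simp only [kronecker_conjTranspose_mul_self, Matrix.conjTranspose_one, Matrix.one_mul]
        rw [← Matrix.one_kronecker_one, ← hk]
        ext x y
        simp [Matrix.sum_apply, Matrix.kroneckerMap, Finset.mul_sum])
      (fun j l hlk => by
        rw [kronecker_conjTranspose_mul_self, hl j l hlk, Matrix.conjTranspose_one, Matrix.one_mul]
        exact Matrix.one_kronecker_one) _ ih
    convert this using 2 with o
    rw [tensorParties_sum_right]
    refine Finset.sum_congr rfl fun j _ => ?_
    rw [← tensorParties_piTensor, ← tensorParties_conj, piTensor_one, Matrix.conjTranspose_one,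
      Matrix.one_mul, Matrix.mul_one]

/-- Two LOCC measurements of separate systems, performed one after the other. -/
theorem IsLOCC.tensorParties {M : Ω₁ → Matrix (∀ k, ι k) (∀ k, ι k) ℂ}
    {N : Ω₂ → Matrix (∀ k, κ k) (∀ k, κ k) ℂ} (hM : IsLOCC ι M) (hN : IsLOCC κ N) :
    IsLOCC (fun k => ι k × κ k) fun o : Ω₁ × Ω₂ =>
      LOCCSeq.tensorParties (M o.1) (N o.2) := by
  induction hM with
  | guess ι c => exact hN.guess_tensorParties c
  | round ι k r ι' B hk hl M hM ih =>
    -- The second systems stay untouched during the rounds of the first protocol.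
    have := IsLOCC.round (fun k => ι k × κ k) k r (fun j l => ι' j l × κ l)
      (fun j l => B j l ⊗ₖ (1 : Matrix (κ l) (κ l) ℂ))
      (by
        simp only [kronecker_conjTranspose_mul_self, Matrix.conjTranspose_one, Matrix.one_mul]
        rw [← Matrix.one_kronecker_one, ← hk]
        ext x y
        simp [Matrix.sum_apply, Matrix.kroneckerMap, Finset.sum_mul])
      (fun j l hlk => by
        rw [kronecker_conjTranspose_mul_self, hl j l hlk, Matrix.conjTranspose_one, Matrix.one_mul]
        exact Matrix.one_kronecker_one) _ ih
    convert this using 2 with o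
    rw [tensorParties_sum_left]
    refine Finset.sum_congr rfl fun j _ => ?_
    rw [← tensorParties_piTensor, ← tensorParties_conj, piTensor_one, Matrix.conjTranspose_one,
      Matrix.one_mul, Matrix.mul_one]

end Product

/-- The measurement of a sequence of multipartite systems by measuring each of them, with the
systems grouped by party. -/
def tensorMeasurement {I : Type} [Fintype I] {ι : I → P → Type} {Ω : I → Type}
    (M : ∀ l, Ω l → Matrix (∀ k, ι l k) (∀ k, ι l k) ℂ) (c : ∀ l, Ω l) :
    Matrix (∀ k l, ι l k) (∀ k l, ι l k) ℂ :=
  (piTensor fun l => M l (c l)).submatrix (fun x l k => x k l) (fun x l k => x k l)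

theorem IsLOCC.tensorMeasurement {L : ℕ} {ι : Fin L → P → Type} [∀ l k, Fintype (ι l k)]
    [∀ l k, DecidableEq (ι l k)] {Ω : Fin L → Type} [∀ l, DecidableEq (Ω l)]
    {M : ∀ l, Ω l → Matrix (∀ k, ι l k) (∀ k, ι l k) ℂ} (hM : ∀ l, IsLOCC (ι l) (M l)) :
    IsLOCC (fun k => ∀ l, ι l k) (LOCCSeq.tensorMeasurement M) := by
  induction L with
  | zero =>
    convert IsLOCC.guess (fun k => ∀ l, ι l k) (fun l => l.elim0 : ∀ l, Ω l) using 1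
    funext c
    rw [if_pos (Subsingleton.elim _ _)]
    ext x y
    rw [Subsingleton.elim x y, Matrix.one_apply_eq]
    simp [LOCCSeq.tensorMeasurement, piTensor]
  | succ L ih =>
    -- `Fin.consEquiv` splits off system 0, both in the outcomes and in each party's basis.
    have h := ((hM 0).tensorParties (ih fun l => hM l.succ)).relabel
      (Fin.consEquiv Ω).symm (κ := fun k => ∀ l, ι l k)
      (fun k => (Fin.consEquiv fun l => ι l k).symm)
    convert h using 2 with c
    ext x y
    simp only [LOCCSeq.tensorMeasurement, piTensor, Matrix.submatrix_apply, Matrix.of_apply,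
      Fin.prod_univ_succ]
    rfl

end LOCC

/-! ### Multiplicativity of the global optimum. -/

section Sequence

variable {I P : Type} [Fintype I] [DecidableEq I] [Fintype P] [DecidableEq P]
  {ι : I → P → Type} [∀ l k, Fintype (ι l k)]
  {Ω : I → Type} [∀ l, Fintype (Ω l)]

theorem trace_submatrix_swap (A : Matrix (∀ l k, ι l k) (∀ l k, ι l k) ℂ) :
    (A.submatrix (fun (x : ∀ k l, ι l k) l k => x k l) (fun x l k => x k l)).trace = A.trace :=
  Equiv.sum_comp (Equiv.piComm fun k l => ι l k) fun z => A z z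

theorem submatrix_swap_mul (A B : Matrix (∀ l k, ι l k) (∀ l k, ι l k) ℂ) :
    A.submatrix (fun (x : ∀ k l, ι l k) l k => x k l) (fun (x : ∀ k l, ι l k) l k => x k l) *
      B.submatrix (fun x l k => x k l) (fun (x : ∀ k l, ι l k) l k => x k l) =
    (A * B).submatrix (fun x l k => x k l) (fun x l k => x k l) :=
  Matrix.submatrix_mul_equiv A B _ (Equiv.piComm fun k l => ι l k) _

variable [∀ l k, DecidableEq (ι l k)]

theorem IsMeasurement.tensorMeasurement {M : ∀ l, Ω l → Matrix (∀ k, ι l k) (∀ k, ι l k) ℂ}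
    (hM : ∀ l, IsMeasurement (M l)) : IsMeasurement (LOCCSeq.tensorMeasurement M) := by
  refine ⟨fun c => (piTensor_posSemidef _ fun l => (hM l).1 (c l)).submatrix _, ?_⟩
  have h := piTensor_sum M
  simp only [(hM _).2, piTensor_one] at h
  rw [← Matrix.submatrix_one_equiv (Equiv.piComm fun k l => ι l k), h]
  ext x y
  simp only [Matrix.sum_apply, Matrix.submatrix_apply]
  rfl

variable (E : ∀ l, Ensemble (Ω l) (∀ k, ι l k))

omit [∀ l k, DecidableEq (ι l k)] in
theorem Ensemble.success_tensorMeasurement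
    {M : ∀ l, Ω l → Matrix (∀ k, ι l k) (∀ k, ι l k) ℂ} (hM : ∀ l c, (M l c).PosSemidef) :
    (Ensemble.tensor E).success (tensorMeasurement M) = ∏ l, (E l).success (M l) := by
  simp only [Ensemble.success, Finset.prod_univ_sum, Fintype.piFinset_univ]
  refine Finset.sum_congr rfl fun c _ => ?_
  have h : ((Ensemble.tensor E).state c * LOCCSeq.tensorMeasurement M c).trace =
      ∏ l, ((E l).state (c l) * M l (c l)).trace := by
    rw [← piTensor_trace, ← piTensor_mul, ← trace_submatrix_swap, ← submatrix_swap_mul]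
    rfl
  -- The real part commutes with this product because each trace, of a product of two positive
  -- semidefinite operators, is real.
  rw [h, Finset.prod_congr rfl fun l _ =>
    (ofReal_trace_mul_re ((E l).state_posSemidef (c l)) (hM l (c l))).symm, ← Complex.ofReal_prod, Complex.ofReal_re, Finset.prod_mul_distrib]
  rfl

theorem Ensemble.prod_pG_le_pG_tensor : ∏ l, pG (E l) ≤ pG (Ensemble.tensor E) := by
  choose M hM hopt using fun l => (E l).exists_success_eq_pG
  simp only [← hopt]
  rw [← Ensemble.success_tensorMeasurement E fun l => (hM l).1]
  exact Ensemble.success_le_pG _ (IsMeasurement.tensorMeasurement hM)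

/-- The tensor product of optimal dual operators is dual feasible by monotonicity, and its trace is
the product of their traces; weak duality concludes. -/
theorem Ensemble.pG_tensor_le_prod_pG : pG (Ensemble.tensor E) ≤ ∏ l, pG (E l) := by
  choose K hK htr using fun l => (E l).exists_dual
  obtain ⟨M, hM, hopt⟩ := (Ensemble.tensor E).exists_success_eq_pG
  have hle := (Ensemble.tensor E).success_le_trace
    (K := (piTensor K).submatrix (fun x l k => x k l) (fun x l k => x k l)) (fun c => ?_) hM
  · rw [trace_submatrix_swap, piTensor_trace] at hle
    simp only [htr, ← Complex.ofReal_prod, Complex.ofReal_re] at hle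
    rwa [← hopt]
  · have h := (piTensor_sub_posSemidef
      (A := fun l => ((E l).prob (c l) : ℂ) • (E l).state (c l)) (B := K)
      (fun l => ((E l).state_posSemidef (c l)).smul
        (by exact_mod_cast ((E l).prob_pos (c l)).le)) (fun l => hK l (c l))).submatrix
        (fun (x : ∀ k l, ι l k) l k => x k l)
    rw [piTensor_smul, ← Complex.ofReal_prod] at h
    exact h

theorem Ensemble.pG_tensor : pG (Ensemble.tensor E) = ∏ l, pG (E l) :=
  le_antisymm (pG_tensor_le_prod_pG E) (prod_pG_le_pG_tensor E)

end Sequence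

theorem Ensemble.prod_pL_le_pL_tensor {P : Type} [Fintype P] [DecidableEq P] {L : ℕ}
    {ι : Fin L → P → Type} [∀ l k, Fintype (ι l k)] [∀ l k, DecidableEq (ι l k)]
    {Ω : Fin L → Type} [∀ l, Fintype (Ω l)] [∀ l, DecidableEq (Ω l)]
    (E : ∀ l, Ensemble (Ω l) (∀ k, ι l k)) :
    ∏ l, pL (E l) ≤ pL (Ensemble.tensor E) := by
  -- The supremum over LOCC need not be attained, so it is approached by a sequence of LOCC values
  -- for each factor.
  choose u hu hlim hmem using fun l => exists_seq_tendsto_sSup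
    (S := {p | ∃ M : Ω l → Matrix (∀ k, ι l k) (∀ k, ι l k) ℂ, IsLOCC (ι l) M ∧
      p = (E l).success M})
    ((E l).nonempty.elim fun c => ⟨_, _, IsLOCC.guess (ι l) c, rfl⟩)
    ⟨1, by rintro _ ⟨M, hM, rfl⟩; exact (E l).success_le_one hM.isMeasurement⟩
  refine le_of_tendsto (tendsto_finsetProd _ fun l _ => hlim l)
    (Filter.Eventually.of_forall fun t => ?_)
  choose M hM hs using fun l => hmem l t
  simp only [hs]
  rw [← success_tensorMeasurement E fun l => (hM l).isMeasurement.1]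
  exact success_le_pL _ (IsLOCC.tensorMeasurement hM)

end LOCCSeq

end

theorem theorem3 (m L : ℕ) (d : Fin L → Fin m → ℕ) (n : Fin L → ℕ)
    (E : ∀ l : Fin L, LOCCSeq.Ensemble (Fin (n l)) (∀ k : Fin m, Fin (d l k))) :
    (∏ l, LOCCSeq.pL (E l) = LOCCSeq.pL (LOCCSeq.Ensemble.tensor E) ∧
      LOCCSeq.pL (LOCCSeq.Ensemble.tensor E) = LOCCSeq.pG (LOCCSeq.Ensemble.tensor E)) ↔
    ∀ l : Fin L, LOCCSeq.pL (E l) = LOCCSeq.pG (E l) := by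
  have hG := LOCCSeq.Ensemble.pG_tensor E
  constructor
  · rintro ⟨h₁, h₂⟩ l
    refine (LOCCSeq.Ensemble.pL_le_pG (E l)).eq_of_not_lt fun hlt => ?_
    -- A single strict gap would give `∏ pL < ∏ pG = pG (⨂)`, against `h₁` and `h₂`.
    have := Finset.prod_lt_prod (fun l _ => LOCCSeq.Ensemble.pL_pos (E l))
      (fun l _ => LOCCSeq.Ensemble.pL_le_pG (E l)) ⟨l, Finset.mem_univ l, hlt⟩
    linarith
  · intro h
    have h₁ := LOCCSeq.Ensemble.prod_pL_le_pL_tensor E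
    have h₂ := LOCCSeq.Ensemble.pL_le_pG (LOCCSeq.Ensemble.tensor E)
    simp only [h] at h₁ ⊢
    constructor <;> linarith
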